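/- Let $n\ge 1$, let $a_1,\dots,a_n\in\mathbb R^2$ be pairwise distinct, and let $D\subset\mathbb R^2$ be a compact convex polygon with nonempty interior. Write $D=\bigcap_{i=1}^{k}\{x\in\mathbb R^2 : \nu_{-i}^\top x\le \zeta_{-i}\}$ with $\nu_{-i}\in\mathbb R^2$, $\zeta_{-i}\in\mathbb R$ and $k$ as small as possible, and let $e_{-i}=\{x\in D : \nu_{-i}^\top x=\zeta_{-i}\}$ for $i=1,\dots,k$ be the edges of $D$. For a weight $\xi\in\mathbb R^n$ and $x\in D$ put $\varphi_\xi(x)=\max_{1\le i\le n}(a_i^\top x-\xi_i)$ and define the set of active indices \[ I_\xi(x)=\{i\in\{1,\dots,n\} : \varphi_\xi(x)=a_i^\top x-\xi_i\}\cup\{-i\in\{-1,\dots,-k\} : x\in e_{-i}\}. \] The weight $\xi$ satisfies the differentiability condition (DC) if $|I_\xi(q)|\le 3$ for all $q\in D$; in this case let $k(\xi)=\{I_\xi(x) : x\in D,\ |I_\xi(x)|=3\}$ be its total configuration. The sectors are the equivalence classes of the relation $\xi\sim\hat\xi\iff k(\xi)=k(\hat\xi)$ on the set of all $\xi\in\mathbb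 R^n$ that satisfy (DC). Then there are only finitely many sectors, and each sector $\Xi\subset\mathbb R^n$ is convex and open. Moreover, each sector is the solution set of a finite system of strict linear inequalities in $\xi$: there are $m\in\mathbb N$, $c_1,\dots,c_m\in\mathbb R^n$ and $b_1,\dots,b_m\in\mathbb R$ with $\Xi=\{\xi\in\mathbb R^n : c_r^\top\xi<b_r \text{ for } r=1,\dots,m\}$. -/

import Mathlib

namespace PowerSectors

/-- The intersection of the `k` closed half-planes `{x | νᵢᵀ x ≤ ζᵢ}` of the Euclidean plane. -/
def halfplaneInter {k : ℕ} (ν : Fin k → EuclideanSpace ℝ (Fin 2)) (ζ : Fin k → ℝ) :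
    Set (EuclideanSpace ℝ (Fin 2)) :=
  {x | ∀ i, inner ℝ (ν i) x ≤ ζ i}

/-- `D` is the intersection of the `k` half-planes given by `ν, ζ`, and no family of fewer
half-planes has intersection `D`. -/
def IsMinimalRepresentation (D : Set (EuclideanSpace ℝ (Fin 2))) {k : ℕ}
    (ν : Fin k → EuclideanSpace ℝ (Fin 2)) (ζ : Fin k → ℝ) : Prop :=
  D = halfplaneInter ν ζ ∧
    ∀ (m : ℕ) (ν' : Fin m → EuclideanSpace ℝ (Fin 2)) (ζ' : Fin m → ℝ),
      D = halfplaneInter ν' ζ' → k ≤ m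

/-- The edge `{x ∈ D | νᵢᵀ x = ζᵢ}` of `D`. -/
def edge (D : Set (EuclideanSpace ℝ (Fin 2))) {k : ℕ}
    (ν : Fin k → EuclideanSpace ℝ (Fin 2)) (ζ : Fin k → ℝ) (i : Fin k) :
    Set (EuclideanSpace ℝ (Fin 2)) :=
  {x | x ∈ D ∧ inner ℝ (ν i) x = ζ i}

/-- The function `φ_ξ(x) = sup {aᵢᵀ x - ξᵢ | i = 1, …, n}` (a finite maximum, for `n ≥ 1`). -/
noncomputable def phi {n : ℕ} (a : Fin n → EuclideanSpace ℝ (Fin 2))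
    (ξ : EuclideanSpace ℝ (Fin n)) (x : EuclideanSpace ℝ (Fin 2)) : ℝ :=
  ⨆ i, (inner ℝ (a i) x - ξ i)

/-- The set `I_ξ(x)` of active indices. The left summand holds the positive indices `1, …, n`
(the affine functions that attain `φ_ξ(x)`), the right summand the negative indices
`-1, …, -k` (the edges of `D` that contain `x`). -/
def activeIndices (D : Set (EuclideanSpace ℝ (Fin 2))) {n k : ℕ}
    (a : Fin n → EuclideanSpace ℝ (Fin 2)) (ν : Fin k → EuclideanSpace ℝ (Fin 2))
    (ζ : Fin k → ℝ) (ξ : EuclideanSpace ℝ (Fin n)) (x : EuclideanSpace ℝ (Fin 2)) :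
    Set (Fin n ⊕ Fin k) :=
  Sum.inl '' {i | phi a ξ x = inner ℝ (a i) x - ξ i} ∪ Sum.inr '' {i | x ∈ edge D ν ζ i}

/-- The differentiability condition (DC): at most three indices are active at any point of `D`. -/
def DC (D : Set (EuclideanSpace ℝ (Fin 2))) {n k : ℕ}
    (a : Fin n → EuclideanSpace ℝ (Fin 2)) (ν : Fin k → EuclideanSpace ℝ (Fin 2))
    (ζ : Fin k → ℝ) (ξ : EuclideanSpace ℝ (Fin n)) : Prop :=
  ∀ q ∈ D, (activeIndices D a ν ζ ξ q).ncard ≤ 3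

/-- The total configuration `k(ξ) = {I_ξ(x) | x ∈ D, |I_ξ(x)| = 3}`. -/
def totalConfiguration (D : Set (EuclideanSpace ℝ (Fin 2))) {n k : ℕ}
    (a : Fin n → EuclideanSpace ℝ (Fin 2)) (ν : Fin k → EuclideanSpace ℝ (Fin 2))
    (ζ : Fin k → ℝ) (ξ : EuclideanSpace ℝ (Fin n)) : Set (Set (Fin n ⊕ Fin k)) :=
  {I | ∃ x ∈ D, (activeIndices D a ν ζ ξ x).ncard = 3 ∧ I = activeIndices D a ν ζ ξ x}

/-- The equivalence relation `ξ ∼ ξ' ↔ k(ξ) = k(ξ')` on the weights that fulfil (DC). -/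
def sectorSetoid (D : Set (EuclideanSpace ℝ (Fin 2))) {n k : ℕ}
    (a : Fin n → EuclideanSpace ℝ (Fin 2)) (ν : Fin k → EuclideanSpace ℝ (Fin 2))
    (ζ : Fin k → ℝ) : Setoid {ξ : EuclideanSpace ℝ (Fin n) // DC D a ν ζ ξ} :=
  Setoid.ker fun ξ => totalConfiguration D a ν ζ ξ.1

/-- The sectors: the equivalence classes of `sectorSetoid`, as subsets of `ℝⁿ`. -/
def sectors (D : Set (EuclideanSpace ℝ (Fin 2))) {n k : ℕ}
    (a : Fin n → EuclideanSpace ℝ (Fin 2)) (ν : Fin k → EuclideanSpace ℝ (Fin 2))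
    (ζ : Fin k → ℝ) : Set (Set (EuclideanSpace ℝ (Fin n))) :=
  {S | ∃ C ∈ (sectorSetoid D a ν ζ).classes, S = Subtype.val '' C}

end PowerSectors

open Filter Topology

namespace PowerSectors

-- The sector of `ξ₀` is the set of `ξ` for which every `I` in the total configuration of `ξ₀`
-- occurs as an active set. Each such `I` has three elements and is rigid
-- (`isRigid_of_mem_totalConfiguration`): the constraints in `I` determine a point that is affine in
-- `ξ`. `I` occurs exactly when all other constraints are strict there, which is a finite system of
-- strict linear inequalities. Occurrence of these `I` suffices by
-- `DC_and_totalConfiguration_eq_of_subset`. Under (DC), every `y` satisfies the first-order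
-- condition for some `I` in the configuration, and this condition does not involve the weight. For
-- a second weight realizing all these `I`, a suitable `y` places the active set of any `q ∈ D`
-- inside one of them, so (DC) holds and no new triple appears.

local notation "E2" => EuclideanSpace ℝ (Fin 2)

/-! ### Constraints active at a point -/

section
variable {n k : ℕ} (a : Fin n → E2) (ν : Fin k → E2) (ζ : Fin k → ℝ)
  (ξ : EuclideanSpace ℝ (Fin n))

/-- The normal of the constraint `s`, when the affine function `i₀` attains the maximum. -/
def normal (i₀ : Fin n) : Fin n ⊕ Fin k → E2 :=
  Sum.elim (fun i => a i - a i₀) ν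

/-- The right-hand side of the constraint `s`, when the affine function `i₀` attains the
maximum. -/
def bound (i₀ : Fin n) : Fin n ⊕ Fin k → ℝ :=
  Sum.elim (fun i => ξ i - ξ i₀) ζ

/-- The constraints in `I`, relative to `i₀`, determine a point. -/
def IsRigid (i₀ : Fin n) (I : Set (Fin n ⊕ Fin k)) : Prop :=
  ∀ d : E2, (∀ s ∈ I, inner ℝ (normal a ν i₀ s) d = 0) → d = 0

/-- The first-order condition for a maximum of `yᵀ x - φ(x)` on `D` at a point with active
set `I`. -/
def IsOptimal (y : E2) (I : Set (Fin n ⊕ Fin k)) : Prop :=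
  ∀ d : E2, (∀ e, Sum.inr e ∈ I → inner ℝ (ν e) d ≤ 0) →
    ∃ i, Sum.inl i ∈ I ∧ inner ℝ y d ≤ inner ℝ (a i) d

variable {a ν ζ ξ}

lemma IsOptimal.mono {y : E2} {I J : Set (Fin n ⊕ Fin k)} (h : IsOptimal a ν y I)
    (hIJ : I ⊆ J) : IsOptimal a ν y J := fun d hd =>
  let ⟨i, hi, hy⟩ := h d fun e he => hd e (hIJ he)
  ⟨i, hIJ hi, hy⟩

lemma le_phi (x : E2) (i : Fin n) : inner ℝ (a i) x - ξ i ≤ phi a ξ x :=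
  le_ciSup (f := fun i => inner ℝ (a i) x - ξ i) (Set.finite_range _).bddAbove i

lemma exists_phi_eq (hn : 0 < n) (x : E2) : ∃ i, phi a ξ x = inner ℝ (a i) x - ξ i := by
  have : Nonempty (Fin n) := ⟨⟨0, hn⟩⟩
  obtain ⟨i, hi⟩ := exists_eq_ciSup_of_finite (f := fun i => inner ℝ (a i) x - ξ i)
  exact ⟨i, hi.symm⟩

lemma continuous_phi (hn : 0 < n) : Continuous (phi a ξ) := by
  have : Nonempty (Fin n) := ⟨⟨0, hn⟩⟩
  have h : phi a ξ = fun x => Finset.univ.sup' Finset.univ_nonempty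
      (fun i => inner ℝ (a i) x - ξ i) := by
    funext x
    rw [Finset.sup'_univ_eq_ciSup]
    rfl
  rw [h]
  exact Continuous.finset_sup'_apply _ fun i _ => by fun_prop

variable {D : Set E2} {x : E2}

@[simp] lemma inl_mem_activeIndices {i : Fin n} :
    Sum.inl i ∈ activeIndices D a ν ζ ξ x ↔ phi a ξ x = inner ℝ (a i) x - ξ i := by
  simp [activeIndices]

@[simp] lemma inr_mem_activeIndices {e : Fin k} :
    Sum.inr e ∈ activeIndices D a ν ζ ξ x ↔ x ∈ D ∧ inner ℝ (ν e) x = ζ e := by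
  simp [activeIndices, edge]

/-- Fixing a maximal index `i₀` turns edges and ties alike into linear constraints, so the cell of
`i₀` in `D` is a polygon. -/
lemma mem_and_active_iff (hD : D = halfplaneInter ν ζ) {i₀ : Fin n} :
    (x ∈ D ∧ Sum.inl i₀ ∈ activeIndices D a ν ζ ξ x) ↔
      ∀ s, inner ℝ (normal a ν i₀ s) x ≤ bound ζ ξ i₀ s := by
  have : Nonempty (Fin n) := ⟨i₀⟩
  rw [inl_mem_activeIndices, hD, Sum.forall, and_comm]
  simp only [normal, bound, Sum.elim_inl, Sum.elim_inr, inner_sub_left]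
  refine and_congr ⟨fun h i => ?_, fun h => le_antisymm (ciSup_le fun i => ?_) (le_phi x i₀)⟩
    Iff.rfl
  · have := le_phi (a := a) (ξ := ξ) x i
    linarith
  · linarith [h i]

lemma mem_active_iff (hx : x ∈ D) {i₀ : Fin n}
    (hi : Sum.inl i₀ ∈ activeIndices D a ν ζ ξ x) (s : Fin n ⊕ Fin k) :
    s ∈ activeIndices D a ν ζ ξ x ↔ inner ℝ (normal a ν i₀ s) x = bound ζ ξ i₀ s := by
  rw [inl_mem_activeIndices] at hi
  rcases s with i | e
  · simp only [inl_mem_activeIndices, normal, bound, Sum.elim_inl, inner_sub_left, hi]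
    constructor <;> intro h <;> linarith
  · simp [normal, bound, hx]

/-! ### Rigid active sets -/

lemma eventually_ray_le {v d : E2} {r : ℝ} (h : inner ℝ v x ≤ r)
    (hd : inner ℝ v x = r → inner ℝ v d = 0) :
    ∀ᶠ t : ℝ in 𝓝 0, inner ℝ v (x + t • d) ≤ r := by
  rcases h.lt_or_eq with h | h
  · have hc : Continuous fun t : ℝ => inner ℝ v (x + t • d) := by fun_prop
    refine (hc.tendsto 0).eventually (p := fun u => u ≤ r) (eventually_le_nhds ?_)
    simpa using h
  · refine Eventually.of_forall fun t => ?_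
    simp [inner_add_right, inner_smul_right, hd h, h]

/-- Every active set of a point of `D` is contained in a rigid one. -/
lemma exists_isRigid (hc : IsCompact D) (hD : D = halfplaneInter ν ζ) (hx : x ∈ D)
    {i₀ : Fin n} (hi : Sum.inl i₀ ∈ activeIndices D a ν ζ ξ x) :
    ∃ z ∈ D, activeIndices D a ν ζ ξ x ⊆ activeIndices D a ν ζ ξ z ∧
      IsRigid a ν i₀ (activeIndices D a ν ζ ξ z) := by
  -- The face of the cell of `i₀` cut out by the constraints active at `x`; it is compact, so it has
  -- an extreme point.
  let F : Set E2 := {z | (∀ s, inner ℝ (normal a ν i₀ s) z ≤ bound ζ ξ i₀ s) ∧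
    ∀ s ∈ activeIndices D a ν ζ ξ x, inner ℝ (normal a ν i₀ s) z = bound ζ ξ i₀ s}
  have hFD : F ⊆ D := fun z hz => ((mem_and_active_iff hD).2 hz.1).1
  have hFclosed : IsClosed F := by
    simp only [F, Set.ofPred_and, Set.ofPred_forall]
    exact (isClosed_iInter fun s => isClosed_le (by fun_prop) continuous_const).inter
      (isClosed_iInter fun s => isClosed_iInter fun _ =>
        isClosed_eq (by fun_prop) continuous_const)
  have hxF : x ∈ F := ⟨(mem_and_active_iff hD).1 ⟨hx, hi⟩, fun s hs => (mem_active_iff hx hi s).1 hs⟩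
  obtain ⟨z, hz⟩ := (hc.of_isClosed_subset hFclosed hFD).extremePoints_nonempty ⟨x, hxF⟩
  have hzF : z ∈ F := hz.1
  obtain ⟨hzD, hzi⟩ := (mem_and_active_iff hD).2 hzF.1
  refine ⟨z, hzD, fun s hs => (mem_active_iff hzD hzi s).2 (hzF.2 s hs), fun d hd => ?_⟩
  -- Along `d` the constraints active at `z` stay constant and the others have slack, so a short
  -- segment centred at `z` lies in `F`; extremality forces `d = 0`.
  have hev : ∀ᶠ t : ℝ in 𝓝 0, z + t • d ∈ F := by
    have h1 : ∀ᶠ t : ℝ in 𝓝 0, ∀ s, inner ℝ (normal a ν i₀ s) (z + t • d) ≤ bound ζ ξ i₀ s :=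
      eventually_all.2 fun s => eventually_ray_le (hzF.1 s) fun h =>
        hd s ((mem_active_iff hzD hzi s).2 h)
    filter_upwards [h1] with t ht
    refine ⟨ht, fun s hs => ?_⟩
    rw [inner_add_right, inner_smul_right,
      hd s ((mem_active_iff hzD hzi s).2 (hzF.2 s hs)), hzF.2 s hs]
    simp
  have hneg : ∀ᶠ t : ℝ in 𝓝 0, z + (-t) • d ∈ F :=
    (show Tendsto (fun t : ℝ => -t) (𝓝 0) (𝓝 0) by
      simpa using (continuous_neg (G := ℝ)).tendsto 0).eventually hev
  obtain ⟨t, ⟨h1, h2⟩, ht⟩ :=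
    (((hev.and hneg).filter_mono nhdsWithin_le_nhds).and
      (self_mem_nhdsWithin : Set.Ioi (0 : ℝ) ∈ 𝓝[>] 0)).exists
  have hseg : z ∈ openSegment ℝ (z + t • d) (z + (-t) • d) :=
    ⟨1 / 2, 1 / 2, by norm_num, by norm_num, by norm_num, by module⟩
  have := hz.2 h1 h2 hseg
  have htd : t • d = 0 := by simpa using this
  exact (smul_eq_zero.1 htd).resolve_left (ne_of_gt ht)

variable (a ν) in
/-- The values of the constraints in `I` other than `i₀`. -/
noncomputable def constraintMap (i₀ : Fin n) (I : Set (Fin n ⊕ Fin k)) :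
    E2 →ₗ[ℝ] (↥(I \ {Sum.inl i₀}) → ℝ) :=
  LinearMap.pi fun s => innerₗ E2 (normal a ν i₀ s.1)

lemma IsRigid.injective {i₀ : Fin n} {I : Set (Fin n ⊕ Fin k)} (h : IsRigid a ν i₀ I) :
    Function.Injective (constraintMap a ν i₀ I) := by
  rw [injective_iff_map_eq_zero]
  intro d hd
  refine h d fun s hs => ?_
  by_cases hs0 : s = Sum.inl i₀
  · simp [hs0, normal]
  · exact congrFun hd ⟨s, hs, hs0⟩

lemma card_diff_active {i₀ : Fin n} {I : Set (Fin n ⊕ Fin k)} (hi : Sum.inl i₀ ∈ I) :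
    Module.finrank ℝ (↥(I \ {Sum.inl i₀}) → ℝ) + 1 = I.ncard := by
  classical
  have := Fintype.ofFinite ↥(I \ {Sum.inl i₀})
  rw [Module.finrank_pi, ← Nat.card_eq_fintype_card, Nat.card_coe_set_eq]
  exact Set.ncard_sdiff_singleton_add_one hi

/-- The constraint of `i₀` reads `0 = 0`, so the remaining `|I| - 1` constraints must embed the
plane. -/
lemma IsRigid.three_le_ncard {i₀ : Fin n} {I : Set (Fin n ⊕ Fin k)} (h : IsRigid a ν i₀ I)
    (hi : Sum.inl i₀ ∈ I) : 3 ≤ I.ncard := by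
  have h1 := LinearMap.finrank_le_finrank_of_injective h.injective
  have h2 := card_diff_active hi
  rw [finrank_euclideanSpace_fin] at h1
  omega

/-! ### Optimality and comparison of configurations -/

/-- Otherwise some feasible direction makes `yᵀ x` grow faster than every active affine function,
and a short step increases the objective. -/
lemma isOptimal_of_isMaxOn (hD : D = halfplaneInter ν ζ) (hx : x ∈ D) {y : E2} (hn : 0 < n)
    (hmax : IsMaxOn (fun z => inner ℝ y z - phi a ξ z) D x) :
    IsOptimal a ν y (activeIndices D a ν ζ ξ x) := by
  intro d hd
  by_contra! hlt
  have hxD : ∀ e, inner ℝ (ν e) x ≤ ζ e := by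
    rw [hD] at hx
    exact hx
  have h1 : ∀ᶠ t : ℝ in 𝓝[>] 0, ∀ e, inner ℝ (ν e) (x + t • d) ≤ ζ e := by
    refine eventually_all.2 fun e => ?_
    rcases (hxD e).lt_or_eq with h | h
    · exact (eventually_ray_le h.le fun h' => absurd h' h.ne).filter_mono nhdsWithin_le_nhds
    · filter_upwards [self_mem_nhdsWithin] with t ht
      have := mul_nonpos_of_nonneg_of_nonpos (le_of_lt ht)
        (hd e (inr_mem_activeIndices.2 ⟨hx, h⟩))
      rw [inner_add_right, inner_smul_right]
      linarith
  have h2 : ∀ᶠ t : ℝ in 𝓝[>] 0, ∀ j,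
      inner ℝ (a j) (x + t • d) - ξ j < phi a ξ x + t * inner ℝ y d := by
    refine eventually_all.2 fun j => ?_
    rcases (le_phi (a := a) (ξ := ξ) x j).lt_or_eq with h | h
    · have hc : Continuous fun t : ℝ =>
          inner ℝ (a j) (x + t • d) - ξ j - (phi a ξ x + t * inner ℝ y d) := by fun_prop
      have := (hc.tendsto 0).eventually (p := fun u => u < 0)
        (eventually_lt_nhds (by simpa using h))
      filter_upwards [this.filter_mono nhdsWithin_le_nhds] with t ht
      linarith
    · filter_upwards [self_mem_nhdsWithin] with t ht
      have := mul_lt_mul_of_pos_left (hlt j (inl_mem_activeIndices.2 h.symm)) ht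
      rw [inner_add_right, inner_smul_right]
      linarith
  obtain ⟨t, ht1, ht2⟩ := (h1.and h2).exists
  have hz : x + t • d ∈ D := by
    rw [hD]
    exact ht1
  obtain ⟨j, hj⟩ := exists_phi_eq (a := a) (ξ := ξ) hn (x + t • d)
  have h3 : inner ℝ y (x + t • d) - phi a ξ (x + t • d) ≤ inner ℝ y x - phi a ξ x := hmax hz
  rw [inner_add_right, inner_smul_right] at h3
  linarith [ht2 j]

/-- The normal cones of the total configuration cover the plane. -/
lemma exists_isOptimal_of_DC (hn : 0 < n) (hc : IsCompact D) (hne : D.Nonempty)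
    (hD : D = halfplaneInter ν ζ) (hξ : DC D a ν ζ ξ) (y : E2) :
    ∃ I ∈ totalConfiguration D a ν ζ ξ, IsOptimal a ν y I := by
  have hcont := continuous_phi (a := a) (ξ := ξ) hn
  obtain ⟨x, hx, hmax⟩ := hc.exists_isMaxOn hne
    (f := fun z => inner ℝ y z - phi a ξ z) (by fun_prop)
  obtain ⟨i, hi⟩ := exists_phi_eq (a := a) (ξ := ξ) hn x
  have hi' : Sum.inl i ∈ activeIndices D a ν ζ ξ x := inl_mem_activeIndices.2 hi
  obtain ⟨z, hz, hsub, hrig⟩ := exists_isRigid hc hD hx hi'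
  exact ⟨_, ⟨z, hz, (hξ z hz).antisymm (hrig.three_le_ncard (hsub hi')), rfl⟩,
    (isOptimal_of_isMaxOn hD hx hn hmax).mono hsub⟩

/-- If the first-order condition for the barycentre of the normals active at `q` holds at `x`, then
all constraints that are active at `q` are active at `x`. -/
lemma active_subset_of_isOptimal (hn : 0 < n) (hD : D = halfplaneInter ν ζ) {q : E2} (hq : q ∈ D) :
    ∃ y : E2, ∀ x ∈ D, IsOptimal a ν y (activeIndices D a ν ζ ξ x) →
      activeIndices D a ν ζ ξ q ⊆ activeIndices D a ν ζ ξ x := by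
  classical
  let P : Finset (Fin n) := {i | phi a ξ q = inner ℝ (a i) q - ξ i}
  let N : Finset (Fin k) := {e | inner ℝ (ν e) q = ζ e}
  have hP : 0 < (P.card : ℝ) := by
    obtain ⟨i, hi⟩ := exists_phi_eq (a := a) (ξ := ξ) hn q
    exact_mod_cast Finset.card_pos.2 ⟨i, by simpa [P] using hi⟩
  -- A subgradient of `φ` at `q` plus a normal vector of `D` at `q`, with all active weights
  -- positive, so that a vanishing weighted sum of slacks kills each slack.
  refine ⟨(P.card : ℝ)⁻¹ • ∑ i ∈ P, a i + ∑ e ∈ N, ν e, fun x hx hopt => ?_⟩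
  have hxD : ∀ e, inner ℝ (ν e) x ≤ ζ e := by
    rw [hD] at hx
    exact hx
  have hqD : ∀ e, inner ℝ (ν e) q ≤ ζ e := by
    rw [hD] at hq
    exact hq
  obtain ⟨i, hi, hle⟩ := hopt (q - x) fun e he => by
    rw [inner_sub_right, (inr_mem_activeIndices.1 he).2]
    linarith [hqD e]
  rw [inl_mem_activeIndices] at hi
  have hphi := le_phi (a := a) (ξ := ξ) q i
  -- The left side equals `yᵀ(q - x) - (φ(q) - φ(x))`. Optimality bounds the first term by `aᵢᵀ(q -
  -- x)`, which is at most `φ(q) - φ(x)` because `i` is active at `x`.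
  have hsum : (P.card : ℝ)⁻¹ * ∑ i ∈ P, (phi a ξ x - (inner ℝ (a i) x - ξ i)) +
      ∑ e ∈ N, (ζ e - inner ℝ (ν e) x) ≤ 0 := by
    have e1 : ∑ i ∈ P, (phi a ξ x - (inner ℝ (a i) x - ξ i)) =
        ∑ i ∈ P, inner ℝ (a i) (q - x) - P.card * (phi a ξ q - phi a ξ x) := by
      rw [← nsmul_eq_mul, ← Finset.sum_const, ← Finset.sum_sub_distrib]
      refine Finset.sum_congr rfl fun i hi => ?_
      have : phi a ξ q = inner ℝ (a i) q - ξ i := by simpa [P] using hi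
      rw [inner_sub_right]
      linarith
    have e2 : ∑ e ∈ N, (ζ e - inner ℝ (ν e) x) = ∑ e ∈ N, inner ℝ (ν e) (q - x) := by
      refine Finset.sum_congr rfl fun e he => ?_
      have : inner ℝ (ν e) q = ζ e := by simpa [N] using he
      rw [inner_sub_right, this]
    rw [inner_add_left, real_inner_smul_left, sum_inner, sum_inner, inner_sub_right] at hle
    rw [e1, e2, mul_sub, ← mul_assoc, inv_mul_cancel₀ hP.ne']
    linarith
  have hnn1 : ∀ i ∈ P, 0 ≤ phi a ξ x - (inner ℝ (a i) x - ξ i) := fun i _ =>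
    sub_nonneg.2 (le_phi x i)
  have hnn2 : ∀ e ∈ N, 0 ≤ ζ e - inner ℝ (ν e) x := fun e _ => sub_nonneg.2 (hxD e)
  have hs1 := mul_nonneg (inv_pos.2 hP).le (Finset.sum_nonneg hnn1)
  have hs2 := Finset.sum_nonneg hnn2
  have hz1 : ∑ i ∈ P, (phi a ξ x - (inner ℝ (a i) x - ξ i)) = 0 :=
    (mul_eq_zero.1 (show (P.card : ℝ)⁻¹ * _ = 0 by linarith)).resolve_left (inv_pos.2 hP).ne'
  have hz2 : ∑ e ∈ N, (ζ e - inner ℝ (ν e) x) = 0 := by linarith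
  rintro (j | e) hs
  · rw [inl_mem_activeIndices] at hs ⊢
    have := (Finset.sum_eq_zero_iff_of_nonneg hnn1).1 hz1 j (by simpa [P] using hs)
    linarith
  · rw [inr_mem_activeIndices] at hs ⊢
    have := (Finset.sum_eq_zero_iff_of_nonneg hnn2).1 hz2 e (by simpa [N] using hs.2)
    exact ⟨hx, by linarith⟩

/-- A weight whose total configuration contains that of a weight with (DC) belongs to the same
sector. -/
lemma DC_and_totalConfiguration_eq_of_subset (hn : 0 < n) (hc : IsCompact D)
    (hD : D = halfplaneInter ν ζ) {ξ' : EuclideanSpace ℝ (Fin n)} (hξ : DC D a ν ζ ξ)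
    (hsub : totalConfiguration D a ν ζ ξ ⊆ totalConfiguration D a ν ζ ξ') :
    DC D a ν ζ ξ' ∧ totalConfiguration D a ν ζ ξ' = totalConfiguration D a ν ζ ξ := by
  have key : ∀ q ∈ D, ∃ I ∈ totalConfiguration D a ν ζ ξ, I.ncard = 3 ∧
      activeIndices D a ν ζ ξ' q ⊆ I := by
    intro q hq
    obtain ⟨y, hy⟩ := active_subset_of_isOptimal (a := a) (ξ := ξ') hn hD hq
    obtain ⟨I, hI, hopt⟩ := exists_isOptimal_of_DC hn hc ⟨q, hq⟩ hD hξ y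
    -- `IsOptimal` depends on `I` alone, so it carries over to the point where `ξ'` has active set
    -- `I`.
    obtain ⟨x, hx, hcard, rfl⟩ := hsub hI
    exact ⟨_, hI, hcard, hy x hx hopt⟩
  refine ⟨fun q hq => ?_, Set.Subset.antisymm ?_ hsub⟩
  · obtain ⟨I, -, hcard, hqI⟩ := key q hq
    exact hcard ▸ Set.ncard_le_ncard hqI
  · rintro _ ⟨q, hq, hcard, rfl⟩
    obtain ⟨I, hI, hIcard, hqI⟩ := key q hq
    rwa [Set.eq_of_subset_of_ncard_le hqI (by omega)]

/-- The active set lies in a rigid active set, which (DC) limits to three elements; hence the two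
agree. -/
lemma isRigid_of_mem_totalConfiguration (hn : 0 < n) (hc : IsCompact D)
    (hD : D = halfplaneInter ν ζ) (hξ : DC D a ν ζ ξ) {I : Set (Fin n ⊕ Fin k)}
    (hI : I ∈ totalConfiguration D a ν ζ ξ) :
    I.ncard = 3 ∧ ∃ i₀, Sum.inl i₀ ∈ I ∧ IsRigid a ν i₀ I := by
  obtain ⟨x, hx, hcard, rfl⟩ := hI
  obtain ⟨i, hi⟩ := exists_phi_eq (a := a) (ξ := ξ) hn x
  have hi' : Sum.inl i ∈ activeIndices D a ν ζ ξ x := inl_mem_activeIndices.2 hi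
  obtain ⟨z, hz, hsub, hrig⟩ := exists_isRigid hc hD hx hi'
  rw [← Set.eq_of_subset_of_ncard_le hsub (by rw [hcard]; exact hξ z hz)] at hrig
  exact ⟨hcard, i, hi', hrig⟩

end

/-! ### Finite systems of strict linear inequalities -/

/-- `S` is the solution set of a finite system of strict linear inequalities. -/
def IsStrictPolyhedron {n : ℕ} (S : Set (EuclideanSpace ℝ (Fin n))) : Prop :=
  ∃ (m : ℕ) (c : Fin m → EuclideanSpace ℝ (Fin n)) (b : Fin m → ℝ),
    S = {ξ | ∀ r, inner ℝ (c r) ξ < b r}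

lemma isStrictPolyhedron_of_finite {n : ℕ} {ι : Type*} [Finite ι]
    (c : ι → EuclideanSpace ℝ (Fin n)) (b : ι → ℝ) :
    IsStrictPolyhedron {ξ | ∀ r, inner ℝ (c r) ξ < b r} := by
  let e := Finite.equivFin ι
  refine ⟨Nat.card ι, c ∘ e.symm, b ∘ e.symm, ?_⟩
  ext ξ
  simp only [Set.mem_ofPred_eq, Function.comp_apply]
  exact (e.symm.forall_congr_right (q := fun r => inner ℝ (c r) ξ < b r)).symm

lemma IsStrictPolyhedron.iInter {n : ℕ} {ι : Type*} [Finite ι]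
    {S : ι → Set (EuclideanSpace ℝ (Fin n))} (h : ∀ i, IsStrictPolyhedron (S i)) :
    IsStrictPolyhedron (⋂ i, S i) := by
  choose m c b hS using h
  convert isStrictPolyhedron_of_finite (ι := Σ i, Fin (m i)) (fun p => c p.1 p.2)
    (fun p => b p.1 p.2) using 1
  ext ξ
  simp [hS, Sigma.forall]

lemma isStrictPolyhedron_affine {n : ℕ} (f : EuclideanSpace ℝ (Fin n) →ₗ[ℝ] ℝ) (b : ℝ) :
    IsStrictPolyhedron {ξ | f ξ < b} := by
  convert isStrictPolyhedron_of_finite (ι := Unit)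
    (fun _ => (InnerProductSpace.toDual ℝ (EuclideanSpace ℝ (Fin n))).symm
      (LinearMap.toContinuousLinearMap f)) (fun _ => b) using 1
  ext ξ
  simp

lemma IsStrictPolyhedron.convex {n : ℕ} {S : Set (EuclideanSpace ℝ (Fin n))}
    (h : IsStrictPolyhedron S) : Convex ℝ S := by
  obtain ⟨m, c, b, rfl⟩ := h
  simp only [Set.ofPred_forall]
  exact convex_iInter fun r => convex_halfSpace_lt (innerₗ _ (c r)).isLinear (b r)

lemma IsStrictPolyhedron.isOpen {n : ℕ} {S : Set (EuclideanSpace ℝ (Fin n))}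
    (h : IsStrictPolyhedron S) : IsOpen S := by
  obtain ⟨m, c, b, rfl⟩ := h
  simp only [Set.ofPred_forall]
  exact isOpen_iInter_of_finite fun r => isOpen_lt (by fun_prop) continuous_const

/-- The weights for which the rigid set `I` occurs as a set of active indices. -/
lemma isStrictPolyhedron_of_isRigid {n k : ℕ} {a : Fin n → E2} {ν : Fin k → E2} {ζ : Fin k → ℝ}
    {D : Set E2} (hD : D = halfplaneInter ν ζ) {I : Set (Fin n ⊕ Fin k)} {i₀ : Fin n}
    (hi : Sum.inl i₀ ∈ I) (hcard : I.ncard = 3) (hrig : IsRigid a ν i₀ I) :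
    IsStrictPolyhedron {ξ | ∃ x ∈ D, activeIndices D a ν ζ ξ x = I} := by
  -- Three constraints minus the trivial one leave two, the dimension of the plane, so
  -- `constraintMap` is invertible.
  have hdim : Module.finrank ℝ E2 = Module.finrank ℝ (↥(I \ {Sum.inl i₀}) → ℝ) := by
    have := card_diff_active hi
    rw [finrank_euclideanSpace_fin]
    omega
  let L := LinearMap.linearEquivOfInjective (constraintMap a ν i₀ I) hrig.injective hdim
  let bl : (Fin n ⊕ Fin k) → EuclideanSpace ℝ (Fin n) →ₗ[ℝ] ℝ :=
    Sum.elim (fun i => (EuclideanSpace.proj i - EuclideanSpace.proj i₀ :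
      EuclideanSpace ℝ (Fin n) →L[ℝ] ℝ).toLinearMap) 0
  let bc : (Fin n ⊕ Fin k) → ℝ := Sum.elim 0 ζ
  have hb : ∀ ξ s, bound ζ ξ i₀ s = bl s ξ + bc s := by
    rintro ξ (i | e) <;> simp [bl, bc, bound]
  let R : EuclideanSpace ℝ (Fin n) →ₗ[ℝ] (↥(I \ {Sum.inl i₀}) → ℝ) :=
    LinearMap.pi fun s => bl s.1
  -- The unique point where the constraints in `I` hold with equality, split into its linear and
  -- constant parts in `ξ`.
  let X : EuclideanSpace ℝ (Fin n) → E2 := fun ξ => L.symm (R ξ) + L.symm fun s => bc s.1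
  have hX : ∀ ξ x, (∀ s ∈ I, inner ℝ (normal a ν i₀ s) x = bound ζ ξ i₀ s) ↔ x = X ξ := by
    intro ξ x
    have : x = X ξ ↔ L x = fun s => bound ζ ξ i₀ s.1 := by
      have hsum : X ξ = L.symm fun s => bound ζ ξ i₀ s.1 := by
        simp only [X, ← map_add]
        exact congrArg L.symm (funext fun s => (hb ξ s.1).symm)
      rw [hsum, LinearEquiv.eq_symm_apply]
    rw [this, funext_iff]
    refine ⟨fun h s => h s.1 s.2.1, fun h s hs => ?_⟩
    by_cases hs0 : s = Sum.inl i₀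
    · simp [hs0, normal, bound]
    · exact h ⟨s, hs, hs0⟩
  have hset : {ξ | ∃ x ∈ D, activeIndices D a ν ζ ξ x = I} =
      ⋂ s : ↥Iᶜ, {ξ | ((innerₗ E2 (normal a ν i₀ s.1)) ∘ₗ L.symm.toLinearMap ∘ₗ R - bl s.1) ξ <
        bc s.1 - inner ℝ (normal a ν i₀ s.1) (L.symm fun s => bc s.1)} := by
    have hlt : ∀ ξ s, ((innerₗ E2 (normal a ν i₀ s)) ∘ₗ L.symm.toLinearMap ∘ₗ R - bl s) ξ <
        bc s - inner ℝ (normal a ν i₀ s) (L.symm fun s => bc s.1) ↔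
        inner ℝ (normal a ν i₀ s) (X ξ) < bound ζ ξ i₀ s := by
      intro ξ s
      rw [hb]
      simp only [X, inner_add_right, LinearMap.sub_apply, LinearMap.comp_apply, innerₗ_apply_apply,
        LinearEquiv.coe_coe]
      constructor <;> intro h <;> linarith
    ext ξ
    simp only [Set.mem_ofPred_eq, Set.mem_iInter, hlt]
    constructor
    · rintro ⟨x, hx, hxI⟩ ⟨s, hs⟩
      have hxi : Sum.inl i₀ ∈ activeIndices D a ν ζ ξ x := hxI ▸ hi
      have hact := mem_active_iff hx hxi
      rw [hxI] at hact
      rw [← (hX ξ x).1 fun s hs => (hact s).1 hs]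
      exact ((mem_and_active_iff hD).1 ⟨hx, hxi⟩ s).lt_of_ne fun h => hs ((hact s).2 h)
    · intro h
      have heq := (hX ξ (X ξ)).2 rfl
      obtain ⟨hx, hxi⟩ := (mem_and_active_iff (a := a) (ξ := ξ) (i₀ := i₀) (x := X ξ) hD).2
        fun s => by
          by_cases hs : s ∈ I
          · exact (heq s hs).le
          · exact (h ⟨s, hs⟩).le
      refine ⟨X ξ, hx, Set.ext fun s => ?_⟩
      rw [mem_active_iff hx hxi]
      exact ⟨fun hs => by_contra fun hsI => (h ⟨s, hsI⟩).ne hs, heq s⟩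
  rw [hset]
  exact IsStrictPolyhedron.iInter fun s => isStrictPolyhedron_affine _ _

/-! ### Sectors -/

lemma finite_sectors {n k : ℕ} (a : Fin n → E2) (D : Set E2) (ν : Fin k → E2) (ζ : Fin k → ℝ) :
    (sectors D a ν ζ).Finite := by
  have h : (sectorSetoid D a ν ζ).classes.Finite := by
    -- Classes embed into the finite type of families of subsets of `Fin n ⊕ Fin k`.
    have : Finite (Quotient (sectorSetoid D a ν ζ)) :=
      Finite.of_injective _ (Setoid.kerLift_injective
        fun ξ : {ξ // DC D a ν ζ ξ} => totalConfiguration D a ν ζ ξ.1)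
    exact Set.finite_coe_iff.1 (Finite.of_equiv _ (Setoid.quotientEquivClasses _))
  refine (h.image fun C => Subtype.val '' C).subset ?_
  rintro S ⟨C, hC, rfl⟩
  exact ⟨C, hC, rfl⟩

lemma isStrictPolyhedron_of_mem_sectors {n k : ℕ} (hn : 0 < n) {a : Fin n → E2} {D : Set E2}
    (hc : IsCompact D) {ν : Fin k → E2} {ζ : Fin k → ℝ} (hD : D = halfplaneInter ν ζ)
    {S : Set (EuclideanSpace ℝ (Fin n))} (hS : S ∈ sectors D a ν ζ) : IsStrictPolyhedron S := by
  obtain ⟨_, ⟨⟨ξ₀, hξ₀⟩, rfl⟩, rfl⟩ := hS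
  have hset : (Subtype.val '' {ξ : {ξ // DC D a ν ζ ξ} | sectorSetoid D a ν ζ ξ ⟨ξ₀, hξ₀⟩}) =
      ⋂ I : totalConfiguration D a ν ζ ξ₀, {ξ | ∃ x ∈ D, activeIndices D a ν ζ ξ x = I.1} := by
    ext ξ
    simp only [Set.mem_iInter, Set.mem_ofPred_eq]
    constructor
    · rintro ⟨⟨ξ, hξ⟩, h, rfl⟩ ⟨I, hI⟩
      have h' : totalConfiguration D a ν ζ ξ = totalConfiguration D a ν ζ ξ₀ := h
      rw [← h'] at hI
      obtain ⟨x, hx, -, hIx⟩ := hI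
      exact ⟨x, hx, hIx.symm⟩
    · intro h
      obtain ⟨h1, h2⟩ := DC_and_totalConfiguration_eq_of_subset hn hc hD (ξ' := ξ) hξ₀
        fun I hI => by
          obtain ⟨x, hx, hIx⟩ := h ⟨I, hI⟩
          change activeIndices D a ν ζ ξ x = I at hIx
          obtain ⟨_, _, hcard, rfl⟩ := hI
          exact ⟨x, hx, hIx ▸ hcard, hIx.symm⟩
      exact ⟨⟨ξ, h1⟩, h2, rfl⟩
  rw [hset]
  refine IsStrictPolyhedron.iInter fun I => ?_
  obtain ⟨hcard, i₀, hi, hrig⟩ := isRigid_of_mem_totalConfiguration hn hc hD hξ₀ I.2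
  exact isStrictPolyhedron_of_isRigid hD hi hcard hrig

end PowerSectors

theorem mainTheorem8 {n k : ℕ} (hn : 0 < n)
    (a : Fin n → EuclideanSpace ℝ (Fin 2)) (ha : Function.Injective a)
    (D : Set (EuclideanSpace ℝ (Fin 2))) (hDcompact : IsCompact D)
    (hDint : (interior D).Nonempty)
    (ν : Fin k → EuclideanSpace ℝ (Fin 2)) (ζ : Fin k → ℝ)
    (hD : PowerSectors.IsMinimalRepresentation D ν ζ) :
    (PowerSectors.sectors D a ν ζ).Finite ∧
    ∀ S ∈ PowerSectors.sectors D a ν ζ,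
      Convex ℝ S ∧ IsOpen S ∧
      ∃ (m : ℕ) (c : Fin m → EuclideanSpace ℝ (Fin n)) (b : Fin m → ℝ),
        S = {ξ | ∀ r, inner ℝ (c r) ξ < b r} := by
  refine ⟨PowerSectors.finite_sectors a D ν ζ, fun S hS => ?_⟩
  have h := PowerSectors.isStrictPolyhedron_of_mem_sectors hn hDcompact hD.1 hS
  exact ⟨h.convex, h.isOpen, h⟩
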